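/- There is an absolute constant $c>0$ such that the following holds for every finite set $A\subset\mathbb{R}$ with $|A|\ge 2$. Let $D=A-A=\{a-b : a,b\in A\}$, $DD=\{xy : x,y\in D\}$, $D/D=\{x/y : x,y\in D,\ y\ne 0\}$ and $$R[A]=\left\{\frac{a_1-a}{a_2-a} : a,a_1,a_2\in A,\ a_2\neq a\right\}.$$ Then $$|DD|\ge c\,|D|^{5/6}\,|R[A]|^{1/4},\qquad |D/D|\ge c\,|D|^{5/6}\,|R[A]|^{1/4},$$ $$|D|^{5/6}\,|R[A]|^{1/4}\ \ge\ c\,|D|^{5/6}\,|A|^{1/2}\,(\log_2|A|)^{-1/4},$$ and, in particular, $$|DD|\ge c\,|D|^{1+\frac1{12}}(\log_2|D|)^{-1/4},\qquad |D/D|\ge c\,|D|^{1+\frac1{12}}(\log_2|D|)^{-1/4}.$$ -/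

import Mathlib

open scoped Pointwise

noncomputable section

/-- The set `R[A]` of all ratios `(a₁ - a) / (a₂ - a)` with `a, a₁, a₂ ∈ A` and `a₂ ≠ a`. -/
def ratioSet (A : Finset ℝ) : Finset ℝ :=
  ((A ×ˢ A ×ˢ A).filter fun t => t.2.2 ≠ t.1).image
    fun t => (t.2.1 - t.1) / (t.2.2 - t.1)

/-- The quotient set `S / S`: all `x / y` with `x, y ∈ S` and `y ≠ 0`. -/
def quotientSet (S : Finset ℝ) : Finset ℝ :=
  ((S ×ˢ S).filter fun t => t.2 ≠ 0).image fun t => t.1 / t.2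

end

/-! Write `R` for `R[A]` and `E` for the nonzero differences. The set `R` is closed under `x ↦ 1 -
x`. So for `d, d' ∈ E` the points `(x d, (1 - x) d')` with `x ∈ R` are `|R|` collinear points of `U
× U`, where `U = {0} ∪ EE/E`. These `|E|²` distinct lines are `|R|`-rich, and Szemerédi–Trotter
gives `|E|² |R|³ ≪ |EE/E|⁴` (`sq_card_mul_card_ratioSet_pow_le`). Plünnecke–Ruzsa bounds `|EE/E|` by
`X³/|E|²` with `X = |EE|` or `|E/E|`, whence `|E|¹⁰ |R|³ ≪ X¹²`.

Separately, equal ratios correspond to collinear triples in `A × A`. There are `O(|A|⁴ log |A|)` of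
these, and Cauchy–Schwarz gives `|R| ≫ |A|² / log |A|` (`sq_card_le_card_ratioSet`). -/

theorem sq_card_le_card_mul_card_eq {α β : Type*} [DecidableEq β] (P : Finset α)
    (V : Finset β) (f : α → β) (hf : ∀ x ∈ P, f x ∈ V) :
    P.card ^ 2 ≤ V.card * ((P ×ˢ P).filter fun z => f z.1 = f z.2).card := by
  classical
  have h1 : P.card = ∑ v ∈ V, (P.filter fun x => f x = v).card :=
    Finset.card_eq_sum_card_fiberwise hf
  have h2 : ((P ×ˢ P).filter fun z => f z.1 = f z.2).card
      = ∑ v ∈ V, (P.filter fun x => f x = v).card ^ 2 := by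
    rw [Finset.card_eq_sum_card_fiberwise (f := fun z : α × α => f z.1) (t := V)]
    · refine Finset.sum_congr rfl fun v _ => ?_
      rw [sq, ← Finset.card_product]
      congr 1
      ext z
      simp only [Finset.mem_filter, Finset.mem_product]
      grind
    · intro z hz
      simp only [Finset.coe_filter, Finset.mem_product, Set.mem_ofPred_eq] at hz
      exact hf _ hz.1.1
  rw [h2]
  calc P.card ^ 2 = (∑ v ∈ V, (P.filter fun x => f x = v).card) ^ 2 := by rw [← h1]
    _ ≤ _ := sq_sum_le_card_mul_sum_sq

/-! ### Szemerédi–Trotter for Cartesian products, by cell partition -/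

/-- The number of elements of `U` below `x`. -/
noncomputable def rankIn (U : Finset ℝ) (x : ℝ) : ℕ := (U.filter fun u => u < x).card

theorem rankIn_mono (U : Finset ℝ) {x y : ℝ} (h : x ≤ y) : rankIn U x ≤ rankIn U y := by
  refine Finset.card_le_card fun u hu => ?_
  simp only [Finset.mem_filter] at hu ⊢
  exact ⟨hu.1, hu.2.trans_le h⟩

theorem rankIn_lt_rankIn {U : Finset ℝ} {x y : ℝ} (hx : x ∈ U) (h : x < y) :
    rankIn U x < rankIn U y := by
  refine Finset.card_lt_card (Finset.ssubset_iff_subset_ne.2 ⟨fun u hu => ?_, fun he => ?_⟩)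
  · simp only [Finset.mem_filter] at hu ⊢
    exact ⟨hu.1, hu.2.trans h⟩
  · have : x ∈ U.filter fun u => u < y := by simp [hx, h]
    rw [← he] at this
    simp at this

theorem rankIn_injOn (U : Finset ℝ) : Set.InjOn (rankIn U) U := by
  intro x hx y hy h
  rcases lt_trichotomy x y with h' | h' | h'
  · exact absurd h (rankIn_lt_rankIn hx h').ne
  · exact h'
  · exact absurd h (rankIn_lt_rankIn hy h').ne'

theorem rankIn_lt_card {U : Finset ℝ} {x : ℝ} (hx : x ∈ U) : rankIn U x < U.card := by
  refine Finset.card_lt_card (Finset.ssubset_iff_subset_ne.2 ⟨Finset.filter_subset _ _, fun he => ?_⟩)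
  rw [← he] at hx
  simp at hx

theorem card_filter_rankIn_div_eq_le (U : Finset ℝ) {t : ℕ} (ht : 0 < t) :
    ((U ×ˢ U).filter fun z => rankIn U z.1 / t = rankIn U z.2 / t).card ≤ U.card * t := by
  have h1 : ((U ×ˢ U).filter fun z => rankIn U z.1 / t = rankIn U z.2 / t).card
      = ∑ x ∈ U, (U.filter fun y => rankIn U x / t = rankIn U y / t).card := by
    simp only [Finset.card_filter, Finset.sum_product]
  rw [h1, ← smul_eq_mul]
  refine Finset.sum_le_card_nsmul _ _ _ fun x _ => ?_
  have h2 : (U.filter fun y => rankIn U x / t = rankIn U y / t).card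
      ≤ (Finset.Ico (rankIn U x / t * t) (rankIn U x / t * t + t)).card := by
    refine Finset.card_le_card_of_injOn (rankIn U) (fun y hy => ?_)
      ((rankIn_injOn U).mono fun y hy => ?_)
    · simp only [Finset.coe_filter, Set.mem_ofPred_eq] at hy
      rw [hy.2]
      simp only [Finset.coe_Ico, Set.mem_Ico]
      have := Nat.div_add_mod' (rankIn U y) t
      have := Nat.mod_lt (rankIn U y) ht
      omega
    · simp only [Finset.coe_filter, Set.mem_ofPred_eq] at hy
      exact hy.1
  simpa using h2

/-- The points of `U × U` on the line `y = ℓ.1 * x + ℓ.2`. -/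
noncomputable def linePoints (U : Finset ℝ) (ℓ : ℝ × ℝ) : Finset (ℝ × ℝ) :=
  (U ×ˢ U).filter fun p => p.2 = ℓ.1 * p.1 + ℓ.2

theorem mem_linePoints {U : Finset ℝ} {ℓ p : ℝ × ℝ} :
    p ∈ linePoints U ℓ ↔ (p.1 ∈ U ∧ p.2 ∈ U) ∧ p.2 = ℓ.1 * p.1 + ℓ.2 := by
  simp [linePoints]

theorem card_linePoints_le (U : Finset ℝ) (ℓ : ℝ × ℝ) : (linePoints U ℓ).card ≤ U.card := by
  refine Finset.card_le_card_of_injOn Prod.fst (fun p hp => (mem_linePoints.1 hp).1.1) ?_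
  intro p hp q hq h
  have h1 := (mem_linePoints.1 hp).2
  have h2 := (mem_linePoints.1 hq).2
  refine Prod.ext h ?_
  rw [h1, h2, h]

/-- Two points lie in the same cell of the partition of `U × U` into blocks of side `t`. -/
def SameCell (U : Finset ℝ) (t : ℕ) (p q : ℝ × ℝ) : Prop :=
  rankIn U p.1 / t = rankIn U q.1 / t ∧ rankIn U p.2 / t = rankIn U q.2 / t

noncomputable instance (U : Finset ℝ) (t : ℕ) (p q : ℝ × ℝ) : Decidable (SameCell U t p q) :=
  inferInstanceAs (Decidable (_ ∧ _))

theorem card_filter_sameCell_le (U : Finset ℝ) {t : ℕ} (ht : 0 < t) :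
    (((U ×ˢ U) ×ˢ (U ×ˢ U)).filter fun z => SameCell U t z.1 z.2).card ≤ (U.card * t) ^ 2 := by
  rw [sq]
  refine le_trans ?_ (Nat.mul_le_mul (card_filter_rankIn_div_eq_le U ht)
    (card_filter_rankIn_div_eq_le U ht))
  rw [← Finset.card_product]
  refine Finset.card_le_card_of_injOn (fun z => ((z.1.1, z.2.1), (z.1.2, z.2.2)))
    (fun z hz => ?_) (fun z _ w _ h => ?_)
  · rw [Finset.mem_coe, Finset.mem_filter] at hz
    simp only [Finset.mem_product, SameCell] at hz
    simp only [Finset.mem_coe, Finset.mem_product, Finset.mem_filter]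
    tauto
  · simp only [Prod.mk.injEq] at h
    ext <;> tauto

/-- A line of nonzero slope is monotone, so it crosses the cells along a staircase and meets at most
`2 * ((U.card - 1) / t) + 1` of them; Cauchy–Schwarz over these cells does the rest. -/
theorem sq_card_linePoints_le (U : Finset ℝ) (t : ℕ) {ℓ : ℝ × ℝ} (hℓ : ℓ.1 ≠ 0) :
    (linePoints U ℓ).card ^ 2 ≤ (2 * ((U.card - 1) / t) + 1) *
      ((linePoints U ℓ ×ˢ linePoints U ℓ).filter fun z => SameCell U t z.1 z.2).card := by
  have hr : ∀ x ∈ U, rankIn U x / t ≤ (U.card - 1) / t := fun x hx =>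
    Nat.div_le_div_right (Nat.le_sub_one_of_lt (rankIn_lt_card hx))
  have hm : ∀ {x y : ℝ}, x ≤ y → rankIn U x / t ≤ rankIn U y / t := fun h =>
    Nat.div_le_div_right (rankIn_mono U h)
  have key : ∀ f : ℝ × ℝ → ℕ,
      (∀ p ∈ linePoints U ℓ, f p ≤ 2 * ((U.card - 1) / t)) →
      (∀ p ∈ linePoints U ℓ, ∀ q ∈ linePoints U ℓ, p.1 ≤ q.1 → f p = f q → SameCell U t p q) →
      (linePoints U ℓ).card ^ 2 ≤ (2 * ((U.card - 1) / t) + 1) *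
      ((linePoints U ℓ ×ˢ linePoints U ℓ).filter fun z => SameCell U t z.1 z.2).card := by
    intro f hf hs
    refine (sq_card_le_card_mul_card_eq (linePoints U ℓ)
      (Finset.range (2 * ((U.card - 1) / t) + 1)) f
      fun p hp => Finset.mem_range_succ_iff.2 (hf p hp)).trans ?_
    rw [Finset.card_range]
    refine Nat.mul_le_mul_left _ (Finset.card_le_card fun z hz => ?_)
    simp only [Finset.mem_filter, Finset.mem_product] at hz ⊢
    refine ⟨hz.1, ?_⟩
    rcases le_total z.1.1 z.2.1 with h | h
    · exact hs _ hz.1.1 _ hz.1.2 h hz.2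
    · have := hs _ hz.1.2 _ hz.1.1 h hz.2.symm
      exact ⟨this.1.symm, this.2.symm⟩
  rcases lt_or_gt_of_ne hℓ with h | h
  -- For a decreasing line the row index is reversed, so that both summands grow with `x` and an
  -- equal sum forces equal cells.
  · refine key (fun p => rankIn U p.1 / t + ((U.card - 1) / t - rankIn U p.2 / t))
      (fun p hp => ?_) (fun p hp q hq hpq he => ?_)
    · rw [two_mul]
      exact Nat.add_le_add (hr _ (mem_linePoints.1 hp).1.1) (Nat.sub_le _ _)
    · have h1 := hm hpq
      have h2 : q.2 ≤ p.2 := by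
        rw [(mem_linePoints.1 hp).2, (mem_linePoints.1 hq).2]
        nlinarith
      have h3 := hm h2
      have h4 := hr _ (mem_linePoints.1 hp).1.2
      constructor <;> omega
  · refine key (fun p => rankIn U p.1 / t + rankIn U p.2 / t)
      (fun p hp => ?_) (fun p hp q hq hpq he => ?_)
    · have := hr _ (mem_linePoints.1 hp).1.1
      have := hr _ (mem_linePoints.1 hp).1.2
      omega
    · have h1 := hm hpq
      have h2 : p.2 ≤ q.2 := by
        rw [(mem_linePoints.1 hp).2, (mem_linePoints.1 hq).2]
        nlinarith
      have h3 := hm h2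
      constructor <;> omega

theorem line_eq_of_mem {U : Finset ℝ} {ℓ ℓ' p q : ℝ × ℝ} (hpq : p ≠ q)
    (hp : p ∈ linePoints U ℓ) (hq : q ∈ linePoints U ℓ)
    (hp' : p ∈ linePoints U ℓ') (hq' : q ∈ linePoints U ℓ') : ℓ = ℓ' := by
  have h1 := (mem_linePoints.1 hp).2
  have h2 := (mem_linePoints.1 hq).2
  have h3 := (mem_linePoints.1 hp').2
  have h4 := (mem_linePoints.1 hq').2
  have hx : p.1 - q.1 ≠ 0 := fun h => hpq (by
    have h' : p.1 = q.1 := sub_eq_zero.1 h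
    exact Prod.ext h' (by rw [h1, h2, h']))
  have hs : ℓ.1 = ℓ'.1 := by
    have : (ℓ.1 - ℓ'.1) * (p.1 - q.1) = 0 := by linear_combination h3 - h1 - h4 + h2
    exact sub_eq_zero.1 ((mul_eq_zero.1 this).resolve_right hx)
  refine Prod.ext hs ?_
  rw [hs] at h1
  linarith

/-- Double count of pairs of distinct points sharing a cell: each such pair lies on at most one
line, and a line with at least twice as many points as cells carries at least `k` pairs. -/
theorem card_mul_le_of_rich (U : Finset ℝ) (L : Finset (ℝ × ℝ)) {k t : ℕ} (ht : 0 < t)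
    (hL : ∀ ℓ ∈ L, ℓ.1 ≠ 0) (hk : ∀ ℓ ∈ L, k ≤ (linePoints U ℓ).card)
    (hkt : 2 * (2 * ((U.card - 1) / t) + 1) ≤ k) :
    L.card * k ≤ (U.card * t) ^ 2 := by
  let G : ℝ × ℝ → Finset ((ℝ × ℝ) × (ℝ × ℝ)) := fun ℓ =>
    ((linePoints U ℓ).offDiag).filter fun z => SameCell U t z.1 z.2
  have hG : ∀ ℓ ∈ L, k ≤ (G ℓ).card := by
    intro ℓ hℓ
    have h1 := sq_card_linePoints_le U t (hL ℓ hℓ)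
    have h2 : ((linePoints U ℓ ×ˢ linePoints U ℓ).filter fun z => SameCell U t z.1 z.2).card
        ≤ (linePoints U ℓ).card + (G ℓ).card := by
      rw [← Finset.diag_card (linePoints U ℓ)]
      refine le_trans (Finset.card_le_card fun z hz => ?_) (Finset.card_union_le _ _)
      simp only [Finset.mem_filter, Finset.mem_product] at hz
      simp only [Finset.mem_union, Finset.mem_diag, G, Finset.mem_filter, Finset.mem_offDiag]
      tauto
    have h3 := hk ℓ hℓ
    set c := (linePoints U ℓ).card
    set V := 2 * ((U.card - 1) / t) + 1
    have hV : 0 < V := Nat.succ_pos _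
    have h4 : c ^ 2 ≤ V * (c + (G ℓ).card) := h1.trans (Nat.mul_le_mul_left _ h2)
    refine h3.trans ?_
    by_contra! hlt
    have : V * (c + (G ℓ).card) < V * (2 * c) := Nat.mul_lt_mul_of_pos_left (by omega) hV
    nlinarith
  have hdisj : Set.PairwiseDisjoint (L : Set (ℝ × ℝ)) G := by
    intro ℓ _ ℓ' _ hne
    refine Finset.disjoint_left.2 fun z hz hz' => hne ?_
    simp only [G, Finset.mem_filter, Finset.mem_offDiag] at hz hz'
    exact line_eq_of_mem hz.1.2.2 hz.1.1 hz.1.2.1 hz'.1.1 hz'.1.2.1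
  calc L.card * k = ∑ _ℓ ∈ L, k := by simp
    _ ≤ ∑ ℓ ∈ L, (G ℓ).card := Finset.sum_le_sum hG
    _ = (L.biUnion G).card := (Finset.card_biUnion hdisj).symm
    _ ≤ (((U ×ˢ U) ×ˢ (U ×ˢ U)).filter fun z => SameCell U t z.1 z.2).card := by
        refine Finset.card_le_card fun z hz => ?_
        simp only [Finset.mem_biUnion, G, Finset.mem_filter, Finset.mem_offDiag,
          mem_linePoints] at hz
        simp only [Finset.mem_filter, Finset.mem_product]
        obtain ⟨ℓ, _, hz⟩ := hz
        tauto
    _ ≤ _ := card_filter_sameCell_le U ht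

/-- The Szemerédi–Trotter bound for the number of `k`-rich lines of a Cartesian product. -/
theorem card_rich_lines_le (U : Finset ℝ) (L : Finset (ℝ × ℝ)) {k : ℕ} (h2 : 2 ≤ k)
    (hL : ∀ ℓ ∈ L, ℓ.1 ≠ 0) (hk : ∀ ℓ ∈ L, k ≤ (linePoints U ℓ).card) :
    L.card * k ^ 3 ≤ 256 * U.card ^ 4 := by
  rcases L.eq_empty_or_nonempty with rfl | ⟨ℓ, hℓ⟩
  · simp
  have hkN : k ≤ U.card := (hk ℓ hℓ).trans (card_linePoints_le U ℓ)
  set N := U.card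
  -- Large enough that a line meets at most `k / 2` cells, yet `t * k ≤ 16 * N` because `k ≤ N`.
  set t := 8 * N / k + 1 with ht
  have hk0 : 0 < k := by omega
  have htk : t * k ≤ 16 * N := by
    have := Nat.div_mul_le_self (8 * N) k
    rw [ht, add_mul]
    omega
  have hcell : 2 * (2 * ((N - 1) / t) + 1) ≤ k := by
    have h1 : 8 * N < t * k := by
      rw [ht, mul_comm _ k]
      exact Nat.lt_mul_div_succ _ hk0
    have h3 : (N - 1) / t * t ≤ N - 1 := Nat.div_mul_le_self _ _
    have h4 : 8 * ((N - 1) / t) < k := by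
      by_contra! hle
      have := Nat.mul_le_mul_left t hle
      nlinarith [Nat.sub_le N 1]
    omega
  have := card_mul_le_of_rich U L (Nat.succ_pos _) hL hk hcell
  calc L.card * k ^ 3 = L.card * k * k ^ 2 := by ring
    _ ≤ (N * t) ^ 2 * k ^ 2 := Nat.mul_le_mul_right _ this
    _ = N ^ 2 * (t * k) ^ 2 := by ring
    _ ≤ N ^ 2 * (16 * N) ^ 2 := by gcongr
    _ = _ := by ring

/-! ### Collinear triples and the size of the ratio set -/

/-- Dyadic decomposition by richness: the cube matches the exponent in `card_rich_lines_le`, so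
every dyadic class contributes equally and one logarithm is lost. -/
theorem sum_card_linePoints_pow_three_le (A : Finset ℝ) (L : Finset (ℝ × ℝ))
    (hL : ∀ ℓ ∈ L, ℓ.1 ≠ 0) (h2 : ∀ ℓ ∈ L, 2 ≤ (linePoints A ℓ).card) :
    ∑ ℓ ∈ L, (linePoints A ℓ).card ^ 3 ≤ Nat.log 2 A.card * (2048 * A.card ^ 4) := by
  have hmaps : ∀ ℓ ∈ L, Nat.log 2 (linePoints A ℓ).card ∈ Finset.Icc 1 (Nat.log 2 A.card) := by
    intro ℓ hℓ
    rw [Finset.mem_Icc]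
    exact ⟨Nat.log_pos one_lt_two (h2 ℓ hℓ), Nat.log_mono_right (card_linePoints_le A ℓ)⟩
  rw [← Finset.sum_fiberwise_of_maps_to hmaps]
  calc _ ≤ ∑ _j ∈ Finset.Icc 1 (Nat.log 2 A.card), 2048 * A.card ^ 4 := ?_
    _ = _ := by simp
  refine Finset.sum_le_sum fun j hj => ?_
  have hj1 : 1 ≤ j := (Finset.mem_Icc.1 hj).1
  set M := L.filter fun ℓ => Nat.log 2 (linePoints A ℓ).card = j with hM
  have hrich : M.card * (2 ^ j) ^ 3 ≤ 256 * A.card ^ 4 := by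
    refine card_rich_lines_le A M ?_ (fun ℓ hℓ => hL ℓ (Finset.mem_filter.1 hℓ).1)
      (fun ℓ hℓ => ?_)
    · calc 2 = 2 ^ 1 := rfl
        _ ≤ 2 ^ j := Nat.pow_le_pow_right two_pos hj1
    · obtain ⟨hℓL, rfl⟩ := Finset.mem_filter.1 hℓ
      exact Nat.pow_log_le_self 2 (by have := h2 ℓ hℓL; omega)
  calc ∑ ℓ ∈ M, (linePoints A ℓ).card ^ 3 ≤ ∑ _ℓ ∈ M, (2 ^ (j + 1)) ^ 3 := by
        refine Finset.sum_le_sum fun ℓ hℓ => Nat.pow_le_pow_left ?_ 3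
        obtain ⟨-, rfl⟩ := Finset.mem_filter.1 hℓ
        exact (Nat.lt_pow_succ_log_self one_lt_two _).le
    _ = 8 * (M.card * (2 ^ j) ^ 3) := by
        rw [Finset.sum_const, smul_eq_mul]
        ring
    _ ≤ 8 * (256 * A.card ^ 4) := Nat.mul_le_mul_left _ hrich
    _ = _ := by ring

/-- The triples `(a, a₁, a₂)` from `A` with `a₁ ≠ a` and `a₂ ≠ a`. -/
noncomputable def ratioTriples (A : Finset ℝ) : Finset (ℝ × ℝ × ℝ) :=
  (A ×ˢ A ×ˢ A).filter fun t => t.2.1 ≠ t.1 ∧ t.2.2 ≠ t.1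

theorem card_ratioTriples (A : Finset ℝ) :
    (ratioTriples A).card = A.card * (A.card - 1) ^ 2 := by
  have : ratioTriples A = A.biUnion fun a => {a} ×ˢ (A.erase a ×ˢ A.erase a) := by
    ext ⟨a, b, c⟩
    simp only [ratioTriples, Finset.mem_filter, Finset.mem_product, Finset.mem_biUnion,
      Finset.mem_singleton, Finset.mem_erase]
    grind
  rw [this, Finset.card_biUnion]
  · rw [Finset.sum_congr rfl (g := fun _ => (A.card - 1) ^ 2)]
    · simp
    · intro a ha
      rw [Finset.card_product, Finset.card_product, Finset.card_erase_of_mem ha]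
      simp [sq]
  · intro a _ b _ hab
    refine Finset.disjoint_left.2 fun t ht ht' => hab ?_
    simp only [Finset.mem_product, Finset.mem_singleton] at ht ht'
    rw [← ht.1, ht'.1]

/-- Two triples have equal ratios exactly when an affine map carries one to the other, so `(a, b)`,
`(a₁, b₁)`, `(a₂, b₂)` lie on its graph, a line of nonzero slope. -/
theorem card_equal_ratios_le (A : Finset ℝ) :
    ((ratioTriples A ×ˢ ratioTriples A).filter fun z =>
      (z.1.2.1 - z.1.1) / (z.1.2.2 - z.1.1) = (z.2.2.1 - z.2.1) / (z.2.2.2 - z.2.1)).card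
      ≤ Nat.log 2 A.card * (2048 * A.card ^ 4) := by
  set S := (ratioTriples A ×ˢ ratioTriples A).filter fun z =>
      (z.1.2.1 - z.1.1) / (z.1.2.2 - z.1.1) = (z.2.2.1 - z.2.1) / (z.2.2.2 - z.2.1) with hS
  let line : (ℝ × ℝ × ℝ) × (ℝ × ℝ × ℝ) → ℝ × ℝ := fun z =>
    ((z.2.2.2 - z.2.1) / (z.1.2.2 - z.1.1),
      z.2.1 - (z.2.2.2 - z.2.1) / (z.1.2.2 - z.1.1) * z.1.1)
  let pts : (ℝ × ℝ × ℝ) × (ℝ × ℝ × ℝ) → (ℝ × ℝ) × (ℝ × ℝ) × (ℝ × ℝ) := fun z =>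
    ((z.1.1, z.2.1), (z.1.2.1, z.2.2.1), (z.1.2.2, z.2.2.2))
  have hmem : ∀ z ∈ S, (line z).1 ≠ 0 ∧ z.1.1 ≠ z.1.2.2 ∧ (pts z).1 ∈ linePoints A (line z) ∧
      (pts z).2.1 ∈ linePoints A (line z) ∧ (pts z).2.2 ∈ linePoints A (line z) := by
    rintro ⟨⟨a, a₁, a₂⟩, ⟨b, b₁, b₂⟩⟩ hz
    simp only [hS, ratioTriples, Finset.mem_filter, Finset.mem_product] at hz
    obtain ⟨⟨⟨⟨ha, ha₁, ha₂⟩, hne₁, hne₂⟩, ⟨hb, hb₁, hb₂⟩, hne₁', hne₂'⟩, heq⟩ := hz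
    have h0 : a₂ - a ≠ 0 := sub_ne_zero.2 hne₂
    have h0' : b₂ - b ≠ 0 := sub_ne_zero.2 hne₂'
    simp only [line, pts, mem_linePoints]
    refine ⟨div_ne_zero h0' h0, hne₂.symm, ⟨⟨ha, hb⟩, by ring⟩, ⟨⟨ha₁, hb₁⟩, ?_⟩,
      ⟨⟨ha₂, hb₂⟩, ?_⟩⟩
    · rw [div_eq_div_iff h0 h0'] at heq
      field_simp
      linear_combination -heq
    · field_simp
      ring
  have hsub : S.card ≤ ((S.image line).biUnion fun ℓ =>
      linePoints A ℓ ×ˢ linePoints A ℓ ×ˢ linePoints A ℓ).card := by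
    refine Finset.card_le_card_of_injOn pts (fun z hz => ?_) (fun z _ w _ h => ?_)
    · have := hmem z hz
      simp only [Finset.mem_coe, Finset.mem_biUnion, Finset.mem_product]
      exact ⟨line z, Finset.mem_image_of_mem _ hz, this.2.2⟩
    · simp only [pts, Prod.mk.injEq] at h
      ext <;> tauto
  refine hsub.trans (Finset.card_biUnion_le.trans ?_)
  refine le_trans (le_of_eq ?_) (sum_card_linePoints_pow_three_le A (S.image line) ?_ ?_)
  · refine Finset.sum_congr rfl fun ℓ _ => ?_
    rw [Finset.card_product, Finset.card_product]
    ring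
  · intro ℓ hℓ
    obtain ⟨z, hz, rfl⟩ := Finset.mem_image.1 hℓ
    exact (hmem z hz).1
  · intro ℓ hℓ
    obtain ⟨z, hz, rfl⟩ := Finset.mem_image.1 hℓ
    have h := hmem z hz
    refine Finset.one_lt_card.2 ⟨_, h.2.2.1, _, h.2.2.2.2, fun he => h.2.1 ?_⟩
    exact congrArg Prod.fst he

theorem sq_card_le_card_ratioSet (A : Finset ℝ) (hA : 2 ≤ A.card) :
    A.card ^ 2 ≤ (ratioSet A).card * (Nat.log 2 A.card * 2 ^ 15) := by
  have h1 := sq_card_le_card_mul_card_eq (ratioTriples A) (ratioSet A)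
    (fun t => (t.2.1 - t.1) / (t.2.2 - t.1)) (fun t ht => by
      simp only [ratioTriples, Finset.mem_filter] at ht
      exact Finset.mem_image_of_mem _ (Finset.mem_filter.2 ⟨ht.1, ht.2.2⟩))
  have h2 := h1.trans (Nat.mul_le_mul_left _ (card_equal_ratios_le A))
  rw [card_ratioTriples] at h2
  set n := A.card
  have h3 : n ^ 6 ≤ 16 * (n * (n - 1) ^ 2) ^ 2 := by
    calc n ^ 6 = n ^ 2 * n ^ 4 := by ring
      -- Since `n ≥ 2`, `n ≤ 2 * (n - 1)`.
      _ ≤ n ^ 2 * (2 * (n - 1)) ^ 4 := by gcongr; omega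
      _ = _ := by ring
  have h4 : n ^ 4 * n ^ 2 ≤ n ^ 4 * ((ratioSet A).card * (Nat.log 2 n * 2 ^ 15)) := by
    calc n ^ 4 * n ^ 2 = n ^ 6 := by ring
      _ ≤ 16 * (n * (n - 1) ^ 2) ^ 2 := h3
      _ ≤ 16 * ((ratioSet A).card * (Nat.log 2 n * (2048 * n ^ 4))) := Nat.mul_le_mul_left _ h2
      _ = _ := by ring
  exact Nat.le_of_mul_le_mul_left h4 (by positivity)

theorem two_le_card_ratioSet (A : Finset ℝ) (hA : 2 ≤ A.card) : 2 ≤ (ratioSet A).card := by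
  obtain ⟨a, ha, b, hb, hab⟩ := Finset.one_lt_card.1 hA
  have hba : b - a ≠ 0 := sub_ne_zero.2 hab.symm
  refine Finset.one_lt_card.2 ⟨0, Finset.mem_image.2 ⟨(a, a, b), ?_, by simp⟩,
    1, Finset.mem_image.2 ⟨(a, b, b), ?_, div_self hba⟩, zero_ne_one⟩ <;>
  simp [ha, hb, hab.symm]

/-! ### Rich lines from differences, and Plünnecke–Ruzsa in `ℝˣ` -/

/-- The nonzero elements of `D`, as units. -/
noncomputable def unitsOf (D : Finset ℝ) : Finset ℝˣ :=
  D.preimage ((↑) : ℝˣ → ℝ) Units.val_injective.injOn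

theorem mem_unitsOf {D : Finset ℝ} {u : ℝˣ} : u ∈ unitsOf D ↔ (u : ℝ) ∈ D := by
  simp [unitsOf]

theorem card_le_card_unitsOf_succ (D : Finset ℝ) : D.card ≤ (unitsOf D).card + 1 := by
  have : D ⊆ insert 0 ((unitsOf D).image ((↑) : ℝˣ → ℝ)) := by
    intro x hx
    rcases eq_or_ne x 0 with rfl | h
    · exact Finset.mem_insert_self _ _
    · exact Finset.mem_insert_of_mem
        (Finset.mem_image.2 ⟨Units.mk0 x h, mem_unitsOf.2 hx, rfl⟩)
  exact (Finset.card_le_card this).trans ((Finset.card_insert_le _ _).trans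
    (Nat.succ_le_succ Finset.card_image_le))

theorem sq_card_mul_card_ratioSet_pow_le (A : Finset ℝ) (hA : 2 ≤ A.card) :
    (unitsOf (A - A)).card ^ 2 * (ratioSet A).card ^ 3 ≤
      4096 * (unitsOf (A - A) ^ 2 / unitsOf (A - A) ^ 1).card ^ 4 := by
  set E := unitsOf (A - A) with hE
  set W := E ^ 2 / E ^ 1 with hW
  -- Zero is needed for the ratios `0` and `1`, which put a point on a coordinate axis.
  let U : Finset ℝ := insert 0 (W.image ((↑) : ℝˣ → ℝ))
  rcases E.eq_empty_or_nonempty with h | hEne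
  · simp [h]
  have hWne : 0 < W.card := Finset.card_pos.2 ((hEne.pow).div (hEne.pow))
  have hU : U.card ≤ 2 * W.card := by
    have h1 : U.card ≤ (W.image ((↑) : ℝˣ → ℝ)).card + 1 := Finset.card_insert_le _ _
    have h2 : (W.image ((↑) : ℝˣ → ℝ)).card ≤ W.card := Finset.card_image_le
    omega
  have hmemU : ∀ a ∈ A, ∀ b ∈ A, ∀ c ∈ A, c ≠ a → ∀ d ∈ E, (b - a) / (c - a) * (d : ℝ) ∈ U := by
    intro a ha b hb c hc hca d hd
    rcases eq_or_ne b a with rfl | hba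
    · simp [U]
    · refine Finset.mem_insert_of_mem (Finset.mem_image.2
        ⟨Units.mk0 _ (sub_ne_zero.2 hba) * d / Units.mk0 _ (sub_ne_zero.2 hca), ?_, ?_⟩)
      · refine Finset.div_mem_div ?_ ?_
        · rw [sq]
          exact Finset.mul_mem_mul (mem_unitsOf.2 (Finset.sub_mem_sub hb ha)) hd
        · rw [pow_one]
          exact mem_unitsOf.2 (Finset.sub_mem_sub hc ha)
      · rw [Units.val_div_eq_div_val, Units.val_mul, Units.val_mk0, Units.val_mk0]
        ring
  let line : ℝˣ × ℝˣ → ℝ × ℝ := fun e => (-((e.2 : ℝ) / e.1), e.2)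
  have hline : Function.Injective line := by
    rintro ⟨d, d'⟩ ⟨e, e'⟩ h
    simp only [line, Prod.mk.injEq, neg_inj] at h
    obtain ⟨h1, h2⟩ := h
    rw [h2, div_eq_div_iff d.ne_zero e.ne_zero] at h1
    exact Prod.ext (Units.ext (mul_left_cancel₀ e'.ne_zero h1).symm) (Units.ext h2)
  have key := card_rich_lines_le U ((E ×ˢ E).image line) (two_le_card_ratioSet A hA) ?_ ?_
  · rw [Finset.card_image_of_injective _ hline, Finset.card_product, ← sq] at key
    calc _ ≤ _ := key
      _ ≤ 256 * (2 * W.card) ^ 4 := by gcongr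
      _ = _ := by ring
  · intro ℓ hℓ
    obtain ⟨e, -, rfl⟩ := Finset.mem_image.1 hℓ
    exact neg_ne_zero.2 (div_ne_zero e.2.ne_zero e.1.ne_zero)
  · intro ℓ hℓ
    obtain ⟨⟨d, d'⟩, he, rfl⟩ := Finset.mem_image.1 hℓ
    obtain ⟨hd, hd'⟩ := Finset.mem_product.1 he
    refine Finset.card_le_card_of_injOn (fun x => (x * (d : ℝ), (1 - x) * (d' : ℝ)))
      (fun x hx => ?_) (fun x _ y _ h => ?_)
    · obtain ⟨⟨a, b, c⟩, ht, rfl⟩ := Finset.mem_image.1 hx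
      simp only [Finset.mem_filter, Finset.mem_product] at ht
      obtain ⟨⟨ha, hb, hc⟩, hca⟩ := ht
      have hca0 : c - a ≠ 0 := sub_ne_zero.2 hca
      refine mem_linePoints.2 ⟨⟨hmemU a ha b hb c hc hca d hd, ?_⟩, ?_⟩
      -- Exchanging the roles of `a` and `c` realises the symmetry `x ↦ 1 - x` of the ratio set.
      · have : 1 - (b - a) / (c - a) = (b - c) / (a - c) := by
          have : a - c ≠ 0 := sub_ne_zero.2 hca.symm
          field_simp
          ring
        dsimp only
        rw [this]
        exact hmemU c hc b hb a ha hca.symm d' hd'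
      · have := d.ne_zero
        simp only [line]
        field_simp
        ring
    · exact mul_right_cancel₀ d.ne_zero (Prod.mk.inj h).1

/-- The hypothesis `hX` is the Plünnecke–Ruzsa bound, kept abstract to serve both the product set
and the quotient set. -/
theorem card_pow_ten_mul_le (A : Finset ℝ) (hA : 2 ≤ A.card) {X : ℕ}
    (hX : ((unitsOf (A - A) ^ 2 / unitsOf (A - A) ^ 1).card : ℚ≥0) ≤
      ((X : ℚ≥0) / (unitsOf (A - A)).card) ^ (2 + 1) * (unitsOf (A - A)).card) :
    ((unitsOf (A - A)).card : ℝ) ^ 10 * ((ratioSet A).card : ℝ) ^ 3 ≤ 4096 * (X : ℝ) ^ 12 := by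
  have h := sq_card_mul_card_ratioSet_pow_le A hA
  set E := unitsOf (A - A)
  set W := (E ^ 2 / E ^ 1).card
  rcases Nat.eq_zero_or_pos E.card with h0 | h0
  · rw [h0, Nat.cast_zero, zero_pow (by norm_num), zero_mul]
    positivity
  have he : (0 : ℝ) < E.card := by exact_mod_cast h0
  have hX' : (W : ℝ) ≤ ((X : ℝ) / E.card) ^ 3 * E.card := by
    have := (NNRat.cast_le (K := ℝ)).2 hX
    push_cast at this
    exact this
  have hW : (W : ℝ) * (E.card : ℝ) ^ 2 ≤ (X : ℝ) ^ 3 := by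
    calc (W : ℝ) * (E.card : ℝ) ^ 2 ≤ ((X : ℝ) / E.card) ^ 3 * E.card * (E.card : ℝ) ^ 2 := by
          gcongr
      _ = _ := by field_simp
  have h' : (E.card : ℝ) ^ 2 * ((ratioSet A).card : ℝ) ^ 3 ≤ 4096 * (W : ℝ) ^ 4 := by
    exact_mod_cast h
  calc (E.card : ℝ) ^ 10 * ((ratioSet A).card : ℝ) ^ 3
      = (E.card : ℝ) ^ 8 * ((E.card : ℝ) ^ 2 * ((ratioSet A).card : ℝ) ^ 3) := by ring
    _ ≤ (E.card : ℝ) ^ 8 * (4096 * (W : ℝ) ^ 4) := by gcongr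
    _ = 4096 * ((W : ℝ) * (E.card : ℝ) ^ 2) ^ 4 := by ring
    _ ≤ 4096 * ((X : ℝ) ^ 3) ^ 4 := by gcongr
    _ = _ := by ring

theorem card_unitsOf_mul_le (D : Finset ℝ) :
    (unitsOf D * unitsOf D).card ≤ (D * D).card := by
  refine Finset.card_le_card_of_injOn ((↑) : ℝˣ → ℝ) (fun u hu => ?_) Units.val_injective.injOn
  obtain ⟨v, hv, w, hw, rfl⟩ := Finset.mem_mul.1 (Finset.mem_coe.1 hu)
  rw [Units.val_mul]
  exact Finset.mul_mem_mul (mem_unitsOf.1 hv) (mem_unitsOf.1 hw)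

theorem card_unitsOf_div_le (D : Finset ℝ) :
    (unitsOf D / unitsOf D).card ≤ (quotientSet D).card := by
  refine Finset.card_le_card_of_injOn ((↑) : ℝˣ → ℝ) (fun u hu => ?_) Units.val_injective.injOn
  obtain ⟨v, hv, w, hw, rfl⟩ := Finset.mem_div.1 (Finset.mem_coe.1 hu)
  rw [Units.val_div_eq_div_val]
  refine Finset.mem_image.2 ⟨((v : ℝ), (w : ℝ)), ?_, rfl⟩
  simp [mem_unitsOf.1 hv, mem_unitsOf.1 hw]

theorem card_le_card_sub_self {A : Finset ℝ} (hA : A.Nonempty) : A.card ≤ (A - A).card :=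
  Finset.card_le_card_sub_right hA

/-! ### Passage to real exponents and the final bounds -/

theorem rpow_bound_of_card_pow_ten_mul_le (A : Finset ℝ) (hA : 2 ≤ A.card) {X Y : ℕ}
    (hXY : X ≤ Y) (hX : ((unitsOf (A - A)).card : ℝ) ^ 10 * ((ratioSet A).card : ℝ) ^ 3
      ≤ 4096 * (X : ℝ) ^ 12) :
    1 / 4 * (((A - A).card : ℝ) ^ (5 / 6 : ℝ) * ((ratioSet A).card : ℝ) ^ (1 / 4 : ℝ)) ≤ Y := by
  have hD : ((A - A).card : ℝ) ≤ 2 * (unitsOf (A - A)).card := by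
    have h1 := card_le_card_unitsOf_succ (A - A)
    have h2 : A.card ≤ (A - A).card := card_le_card_sub_self (Finset.card_pos.1 (by omega))
    have : (A - A).card ≤ 2 * (unitsOf (A - A)).card := by omega
    exact_mod_cast this
  have hXY' : (X : ℝ) ≤ Y := by exact_mod_cast hXY
  refine le_of_pow_le_pow_left₀ (n := 12) (by norm_num) (by positivity) ?_
  have e1 : (((A - A).card : ℝ) ^ (5 / 6 : ℝ)) ^ 12 = ((A - A).card : ℝ) ^ 10 := by
    rw [← Real.rpow_mul_natCast (by positivity), ← Real.rpow_natCast]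
    norm_num
  have e2 : (((ratioSet A).card : ℝ) ^ (1 / 4 : ℝ)) ^ 12 = ((ratioSet A).card : ℝ) ^ 3 := by
    rw [← Real.rpow_mul_natCast (by positivity), ← Real.rpow_natCast]
    norm_num
  rw [mul_pow, mul_pow, e1, e2]
  calc (1 / 4 : ℝ) ^ 12 * (((A - A).card : ℝ) ^ 10 * ((ratioSet A).card : ℝ) ^ 3)
      ≤ (1 / 4 : ℝ) ^ 12 * ((2 * (unitsOf (A - A)).card) ^ 10 * ((ratioSet A).card : ℝ) ^ 3) := by
        gcongr
    _ = (1 / 4 : ℝ) ^ 12 * 2 ^ 10 *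
        (((unitsOf (A - A)).card : ℝ) ^ 10 * ((ratioSet A).card : ℝ) ^ 3) := by ring
    _ ≤ (1 / 4 : ℝ) ^ 12 * 2 ^ 10 * (4096 * (X : ℝ) ^ 12) := by gcongr
    -- The constants multiply to `2⁻²⁴ · 2¹⁰ · 2¹² = 1/4`.
    _ ≤ (X : ℝ) ^ 12 := by nlinarith [pow_nonneg (Nat.cast_nonneg (α := ℝ) X) 12]
    _ ≤ (Y : ℝ) ^ 12 := by gcongr

theorem card_rpow_half_mul_le (A : Finset ℝ) (hA : 2 ≤ A.card) :
    1 / 16 * ((A.card : ℝ) ^ (1 / 2 : ℝ) * Real.logb 2 (A.card : ℝ) ^ (-(1 / 4) : ℝ))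
      ≤ ((ratioSet A).card : ℝ) ^ (1 / 4 : ℝ) := by
  have hlog : 1 ≤ Real.logb 2 (A.card : ℝ) := by
    rw [Real.le_logb_iff_rpow_le one_lt_two (by positivity)]
    rw [Real.rpow_one]
    exact_mod_cast hA
  have hnat : (Nat.log 2 A.card : ℝ) ≤ Real.logb 2 A.card := by
    exact_mod_cast Real.natLog_le_logb A.card 2
  have h : (A.card : ℝ) ^ 2 ≤ (ratioSet A).card * (Nat.log 2 A.card * 2 ^ 15) := by
    exact_mod_cast sq_card_le_card_ratioSet A hA
  set l := Real.logb 2 (A.card : ℝ)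
  have hl : 0 < l := by linarith
  refine le_of_pow_le_pow_left₀ (n := 4) (by norm_num) (by positivity) ?_
  have e1 : ((A.card : ℝ) ^ (1 / 2 : ℝ)) ^ 4 = (A.card : ℝ) ^ 2 := by
    rw [← Real.rpow_mul_natCast (by positivity), ← Real.rpow_natCast]
    norm_num
  have e2 : (((ratioSet A).card : ℝ) ^ (1 / 4 : ℝ)) ^ 4 = ((ratioSet A).card : ℝ) := by
    rw [← Real.rpow_mul_natCast (by positivity)]
    norm_num
  have e3 : (l ^ (-(1 / 4) : ℝ)) ^ 4 = l⁻¹ := by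
    rw [← Real.rpow_mul_natCast hl.le, ← Real.rpow_neg_one]
    norm_num
  rw [mul_pow, mul_pow, e1, e2, e3]
  have h2 : (A.card : ℝ) ^ 2 * l⁻¹ ≤ (ratioSet A).card * 2 ^ 15 := by
    rw [← div_eq_mul_inv, div_le_iff₀ hl]
    calc (A.card : ℝ) ^ 2 ≤ (ratioSet A).card * (Nat.log 2 A.card * 2 ^ 15) := h
      _ ≤ (ratioSet A).card * (l * 2 ^ 15) := by gcongr
      _ = _ := by ring
  have h3 : (0 : ℝ) ≤ (ratioSet A).card := Nat.cast_nonneg _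
  linarith

/-- Uses `|D| ≤ |A|²` for the power and `|A| ≤ |D|` for the logarithm, whose exponent is negative.
-/
theorem card_sub_rpow_mul_le (A : Finset ℝ) (hA : 2 ≤ A.card) :
    ((A - A).card : ℝ) ^ (1 + 1 / 12 : ℝ) *
        Real.logb 2 ((A - A).card : ℝ) ^ (-(1 / 4) : ℝ) ≤
      ((A - A).card : ℝ) ^ (5 / 6 : ℝ) *
        ((A.card : ℝ) ^ (1 / 2 : ℝ) * Real.logb 2 (A.card : ℝ) ^ (-(1 / 4) : ℝ)) := by
  have h2 : A.card ≤ (A - A).card := card_le_card_sub_self (Finset.card_pos.1 (by omega))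
  have hD : (0 : ℝ) < (A - A).card := by exact_mod_cast (by omega : 0 < (A - A).card)
  have hA' : (2 : ℝ) ≤ A.card := by exact_mod_cast hA
  have hlog : 0 < Real.logb 2 (A.card : ℝ) := Real.logb_pos one_lt_two (by linarith)
  have e : ((A - A).card : ℝ) ^ (1 + 1 / 12 : ℝ) =
      ((A - A).card : ℝ) ^ (5 / 6 : ℝ) * ((A - A).card : ℝ) ^ (1 / 4 : ℝ) := by
    rw [← Real.rpow_add hD]
    norm_num
  have h3 : ((A - A).card : ℝ) ^ (1 / 4 : ℝ) ≤ (A.card : ℝ) ^ (1 / 2 : ℝ) := by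
    have h4 : ((A - A).card : ℝ) ≤ (A.card : ℝ) ^ 2 := by
      rw [sq]
      exact_mod_cast Finset.card_sub_le (s := A) (t := A)
    calc ((A - A).card : ℝ) ^ (1 / 4 : ℝ) ≤ ((A.card : ℝ) ^ 2) ^ (1 / 4 : ℝ) := by gcongr
      _ = _ := by
        rw [← Real.rpow_natCast_mul (by positivity)]
        norm_num
  have h5 : Real.logb 2 ((A - A).card : ℝ) ^ (-(1 / 4) : ℝ) ≤
      Real.logb 2 (A.card : ℝ) ^ (-(1 / 4) : ℝ) := by
    refine Real.rpow_le_rpow_of_nonpos hlog ?_ (by norm_num)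
    exact Real.logb_le_logb_of_le one_lt_two (by linarith) (by exact_mod_cast h2)
  have h6 : 0 ≤ Real.logb 2 ((A - A).card : ℝ) ^ (-(1 / 4) : ℝ) :=
    Real.rpow_nonneg (hlog.le.trans
      (Real.logb_le_logb_of_le one_lt_two (by linarith) (by exact_mod_cast h2))) _
  rw [e, mul_assoc]
  gcongr

theorem theoremt :
    ∃ c : ℝ, 0 < c ∧ ∀ A : Finset ℝ, 2 ≤ A.card → ∀ D : Finset ℝ, D = A - A →
      -- the lower bounds in terms of `R[A]`
      (c * ((D.card : ℝ) ^ (5 / 6 : ℝ) * ((ratioSet A).card : ℝ) ^ (1 / 4 : ℝ))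
          ≤ ((D * D).card : ℝ) ∧
        c * ((D.card : ℝ) ^ (5 / 6 : ℝ) * ((ratioSet A).card : ℝ) ^ (1 / 4 : ℝ))
          ≤ ((quotientSet D).card : ℝ)) ∧
      -- the comparison of the two lower bounds
      c * ((D.card : ℝ) ^ (5 / 6 : ℝ) * (A.card : ℝ) ^ (1 / 2 : ℝ)
            * Real.logb 2 (A.card : ℝ) ^ (-(1 / 4) : ℝ))
          ≤ (D.card : ℝ) ^ (5 / 6 : ℝ) * ((ratioSet A).card : ℝ) ^ (1 / 4 : ℝ) ∧
      -- the lower bounds in terms of `|D|` alone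
      (c * ((D.card : ℝ) ^ (1 + 1 / 12 : ℝ) * Real.logb 2 (D.card : ℝ) ^ (-(1 / 4) : ℝ))
          ≤ ((D * D).card : ℝ) ∧
        c * ((D.card : ℝ) ^ (1 + 1 / 12 : ℝ) * Real.logb 2 (D.card : ℝ) ^ (-(1 / 4) : ℝ))
          ≤ ((quotientSet D).card : ℝ)) := by
  -- The product of `1 / 4` from the product and quotient bounds and `1 / 16` from the ratio set
  -- bound.
  refine ⟨1 / 64, by norm_num, ?_⟩
  rintro A hA _ rfl
  have hne : (unitsOf (A - A)).Nonempty := by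
    have h1 := card_le_card_unitsOf_succ (A - A)
    have h2 : A.card ≤ (A - A).card := card_le_card_sub_self (Finset.card_pos.1 (by omega))
    exact Finset.card_pos.1 (by omega)
  have hmul := rpow_bound_of_card_pow_ten_mul_le A hA (card_unitsOf_mul_le (A - A))
    (card_pow_ten_mul_le A hA (Finset.pluennecke_ruzsa_inequality_pow_div_pow_mul hne _ 2 1))
  have hdiv := rpow_bound_of_card_pow_ten_mul_le A hA (card_unitsOf_div_le (A - A))
    (card_pow_ten_mul_le A hA (Finset.pluennecke_ruzsa_inequality_pow_div_pow_div hne _ 2 1))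
  have hR := mul_le_mul_of_nonneg_left (card_rpow_half_mul_le A hA)
    (Real.rpow_nonneg (Nat.cast_nonneg (α := ℝ) (A - A).card) (5 / 6))
  have hDA := card_sub_rpow_mul_le A hA
  have hpos : 0 ≤ ((A - A).card : ℝ) ^ (5 / 6 : ℝ) * ((ratioSet A).card : ℝ) ^ (1 / 4 : ℝ) := by
    positivity
  have hlog : 0 ≤ Real.logb 2 (A.card : ℝ) ^ (-(1 / 4) : ℝ) :=
    Real.rpow_nonneg (Real.logb_nonneg one_lt_two (by exact_mod_cast (by omega : 1 ≤ A.card))) _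
  have hpos' : 0 ≤ ((A - A).card : ℝ) ^ (5 / 6 : ℝ) *
      ((A.card : ℝ) ^ (1 / 2 : ℝ) * Real.logb 2 (A.card : ℝ) ^ (-(1 / 4) : ℝ)) := by
    positivity
  refine ⟨⟨?_, ?_⟩, ?_, ?_, ?_⟩
  · linarith
  · linarith
  · rw [mul_assoc (((A - A).card : ℝ) ^ (5 / 6 : ℝ))]
    linarith
  · linarith
  · linarith
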